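/- Let $d\in\mathbb N$, $p>0$, and let $W=\{W(t),\,t\in\mathbb R^d\}$ be a path-continuous, intrinsically stationary Gaussian random field (i.e. for every $h\in\mathbb R^d$ the increment field $W(\cdot+h)-W(\cdot)$ is weakly stationary) with $\mathbb E\,W(t)=0$, variance $\sigma^2(t)=\operatorname{Var}W(t)$ and $W(0)=0$ almost surely. Put $\xi(t)=W(t)-\sigma^2(t)/2$ and assume that $\xi(t)\to-\infty$ almost surely as $|t|\to\infty$. Let $W_i$, $i\in\mathbb N$, be i.i.d. copies of $W$, put $\xi_i(t)=W_i(t)-\sigma^2(t)/2$, and let $(X_i)_{i\in\mathbb N}$ be random variables, independent of $(W_i)_{i\in\mathbb N}$, such that $\sum_{i}\delta_{X_i}$ is a Poisson point process on $\mathbb R$ with intensity measure $e^{-x}\,dx$. On the lattice $p\mathbb Z^d$ let $$T_i^{(p)}=\min\Big(\operatorname*{argmax}_{t\in p\mathbb Z^d}\xi_i(t)\Big),\qquad M_i^{(p)}=\max_{t\in p\mathbb Z^d}\xi_i(t),\qquad F_i^{(p)}(t)=\xi_i\big(t+T_i^{(p)}\big)-M_i^{(p)}\quad(t\in p\mathbb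 Z^d),$$ where the minimum is taken in the lexicographic order (the maximum is almost surely attained), and define $T^{(p)}$ in the same way from $\xi$. Then there are a constant $\lambda^{(p)}>0$ and a probability measure $Q^{(p)}$ on $\mathbb R^{p\mathbb Z^d}$ such that $\sum_{i}\delta_{(T_i^{(p)},\,X_i+M_i^{(p)},\,F_i^{(p)})}$ is a Poisson point process on $p\mathbb Z^d\times\mathbb R\times\mathbb R^{p\mathbb Z^d}$ with intensity measure $$\lambda^{(p)}\,p^d\sum_{t\in p\mathbb Z^d}\delta_t\;\otimes\;e^{-u}\,du\;\otimes\;Q^{(p)}.$$ Moreover $\mathbb P(T^{(p)}=0)>0$, and for every such pair $(\lambda^{(p)},Q^{(p)})$ the shape measure $Q^{(p)}$ is the conditional distribution of $\big(W(t)-\tfrac{\sigma^2(t)}2\big)_{t\in p\mathbb Z^d}$ given $T^{(p)}=0$: $$Q^{(p)}(A)=\mathbb P\Big(\big(W(t)-\tfrac{\sigma^2(t)}2\big)_{t\in p\mathbb Z^d}\in A\ \Big|\ T^{(p)}=0\Big)\qquad\text{for all measurable }A\subseteq\mathbb R^{p\mathbb Z^d}.$$ -/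

import Mathlib

open MeasureTheory ProbabilityTheory Filter Topology

noncomputable section

namespace BrownResnick

/-! ### Gaussian random fields on `ℝ^d` -/

/-- A real random field `Z` on `ℝ^d` is weakly stationary: it has second moments, its mean is
constant, and `Cov(Z(x + t), Z(t))` does not depend on `t`. -/
structure IsWeaklyStationary {d : ℕ} {Ω : Type*} [MeasurableSpace Ω]
    (Z : EuclideanSpace ℝ (Fin d) → Ω → ℝ) (P : Measure Ω) : Prop where
  memLp : ∀ t, MemLp (Z t) 2 P
  mean : ∀ s t, ∫ ω, Z s ω ∂P = ∫ ω, Z t ω ∂P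
  covariance : ∀ x s t, cov[Z (x + s), Z s; P] = cov[Z (x + t), Z t; P]

/-- `W` is intrinsically stationary: for every `h`, the increment field
`x ↦ W(x + h) - W(x)` is weakly stationary. -/
def IsIntrinsicallyStationary {d : ℕ} {Ω : Type*} [MeasurableSpace Ω]
    (W : EuclideanSpace ℝ (Fin d) → Ω → ℝ) (P : Measure Ω) : Prop :=
  ∀ h, IsWeaklyStationary (fun x ω ↦ W (x + h) ω - W x ω) P

/-- A centred, intrinsically stationary Gaussian random field on `ℝ^d` with continuous paths. -/
structure IsCentredIntrinsicGaussianField {d : ℕ} {Ω : Type*} [MeasurableSpace Ω]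
    (W : EuclideanSpace ℝ (Fin d) → Ω → ℝ) (P : Measure Ω) : Prop where
  measurable : ∀ t, Measurable (W t)
  continuous_paths : ∀ ω, Continuous fun t ↦ W t ω
  gaussian : IsGaussianProcess W P
  mean_zero : ∀ t, ∫ ω, W t ω ∂P = 0
  intrinsic : IsIntrinsicallyStationary W P

/-- `t ↦ v(t) - σ²(t) / 2`, for a path `v` and the variance function `σ²(t) = Var W(t)` of the
field `W`. -/
def driftPath {d : ℕ} {Ω : Type*} [MeasurableSpace Ω]
    (W : EuclideanSpace ℝ (Fin d) → Ω → ℝ) (P : Measure Ω)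
    (v : EuclideanSpace ℝ (Fin d) → ℝ) (t : EuclideanSpace ℝ (Fin d)) : ℝ :=
  v t - variance (W t) P / 2

/-! ### The lattice `p ℤ^d` and functions on it -/

/-- The lattice `p ℤ^d` in `ℝ^d`. -/
def lattice (d : ℕ) (p : ℝ) : AddSubgroup (EuclideanSpace ℝ (Fin d)) where
  carrier := {t | ∃ k : Fin d → ℤ, ∀ i, t i = p * k i}
  zero_mem' := ⟨0, fun i ↦ by simp⟩
  add_mem' := by
    rintro a b ⟨k, hk⟩ ⟨l, hl⟩
    exact ⟨k + l, fun i ↦ by simp [hk, hl, mul_add]⟩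
  neg_mem' := by
    rintro a ⟨k, hk⟩
    exact ⟨-k, fun i ↦ by simp [hk]⟩

/-- `t` is the lexicographically smallest point at which `f : p ℤ^d → ℝ` attains its maximum. -/
def IsSmallestArgmax {d : ℕ} {p : ℝ} (f : lattice d p → ℝ) (t : lattice d p) : Prop :=
  (∀ s, f s ≤ f t) ∧
    ∀ t' : lattice d p, (∀ s, f s ≤ f t') →
      toLex (WithLp.ofLp (t : EuclideanSpace ℝ (Fin d))) ≤
        toLex (WithLp.ofLp (t' : EuclideanSpace ℝ (Fin d)))

open Classical in
/-- The lexicographically smallest maximizer of `f : p ℤ^d → ℝ` (and `0` if there is none). -/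
def smallestArgmax {d : ℕ} {p : ℝ} (f : lattice d p → ℝ) : lattice d p :=
  if h : ∃ t, IsSmallestArgmax f t then h.choose else 0

/-- For `f : p ℤ^d → ℝ`, the triple `(T, x + M, F)` made of the smallest maximizer `T` of `f`,
the maximum `M` of `f` raised by `x`, and the shape `F = f(· + T) - M`. -/
def decompose {d : ℕ} {p : ℝ} (x : ℝ) (f : lattice d p → ℝ) :
    lattice d p × ℝ × (lattice d p → ℝ) :=
  (smallestArgmax f, x + ⨆ t, f t, fun t ↦ f (t + smallestArgmax f) - ⨆ s, f s)

/-! ### Poisson point processes -/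

/-- The Poisson distribution with parameter `m ∈ [0, ∞]` on `[0, ∞]`
(for `m = ∞` it is the point mass at `∞`). -/
def poissonLaw (m : ENNReal) : Measure ENNReal :=
  if m = ⊤ then Measure.dirac ⊤ else (poissonMeasure m.toNNReal).map fun n : ℕ ↦ (n : ENNReal)

/-- The random counting measure `∑ i, δ_{Y i}`. -/
def pointMeasure {Ω S : Type*} [MeasurableSpace S] (Y : ℕ → Ω → S) (ω : Ω) : Measure S :=
  Measure.sum fun i ↦ Measure.dirac (Y i ω)

/-- `∑ i, δ_{Y i}` is a Poisson point process with intensity measure `μ`. -/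
structure IsPoissonPointProcess {Ω S : Type*} [MeasurableSpace Ω] [MeasurableSpace S]
    (Y : ℕ → Ω → S) (μ : Measure S) (P : Measure Ω) : Prop where
  hasLaw : ∀ A, MeasurableSet A →
    HasLaw (fun ω ↦ pointMeasure Y ω A) (poissonLaw (μ A)) P
  indep : ∀ (n : ℕ) (A : Fin n → Set S), (∀ j, MeasurableSet (A j)) →
    Pairwise (fun j k ↦ Disjoint (A j) (A k)) →
      iIndepFun (fun j ω ↦ pointMeasure Y ω (A j)) P

/-- The measure `e^{-x} dx` on `ℝ`. -/
def expNegMeasure : Measure ℝ :=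
  volume.withDensity fun x ↦ ENNReal.ofReal (Real.exp (-x))

/-- The product measure `l p^d (∑_{t ∈ p ℤ^d} δ_t) ⊗ e^{-u} du ⊗ Q` on
`p ℤ^d × ℝ × ℝ^{p ℤ^d}`. -/
def productIntensity (d : ℕ) (p l : ℝ) (Q : Measure (lattice d p → ℝ)) :
    Measure (lattice d p × ℝ × (lattice d p → ℝ)) :=
  ENNReal.ofReal (l * p ^ d) • (Measure.count.prod (expNegMeasure.prod Q))

/-- `Q` is the shape measure, and `l` the constant, of the lattice decomposition: `l > 0`, `Q` is
a probability measure, and the points `(T i, X i + M i, F i)` obtained from the heights `X i` and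
the paths `ξ i` restricted to `p ℤ^d` form a Poisson point process whose intensity measure is
`l p^d (∑_{t ∈ p ℤ^d} δ_t) ⊗ e^{-u} du ⊗ Q`. -/
structure IsLatticeDecomposition {d : ℕ} {Ω : Type*} [MeasurableSpace Ω] (p : ℝ)
    (X : ℕ → Ω → ℝ) (ξ : ℕ → Ω → EuclideanSpace ℝ (Fin d) → ℝ) (P : Measure Ω)
    (l : ℝ) (Q : Measure (lattice d p → ℝ)) : Prop where
  pos : 0 < l
  isProbabilityMeasure : IsProbabilityMeasure Q
  isPoisson : IsPoissonPointProcess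
    (fun i ω ↦ decompose (X i ω) fun t : lattice d p ↦ ξ i ω t) (productIntensity d p l Q) P

end BrownResnick

end

/-! Marking attaches independent lattice paths to the heights: the pairs (X_i, ξ_i) form a Poisson
process with intensity e^{-x}dx ⊗ ν, where ν is the law of ξ on the lattice. The triple is a
measurable function of the pair, so the triples are Poisson as well, and only the image intensity
has to be computed (`map_decompose_apply`).

If t is the smallest maximizer of f, the triple is (t, x + f(t), f(·+t) - f(t)), and translating
e^{-x}dx by f(t) produces a factor e^{f(t)}. The lexicographic order is translation invariant, so
T(f) = t exactly when the recentred path f(·+t) - f(t) has smallest maximizer 0. A Cameron–Martin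
formula (`lintegral_shift_eq`) removes the factor: weighted by e^{ξ(t)}, the path ξ(·+t) - ξ(t) has
the law of ξ. Hence every site t contributes the same measure, e^{-u}du times ν restricted to {T =
0}. This gives the product form with λ p^d = P(T = 0) and Q the conditional law. If P(T = 0) were 0,
the image intensity would vanish, although e^{-x}dx ⊗ ν does not.

The Cameron–Martin formula compares moment generating functions: stationary increments express
covariances through variances, and the Gaussian exponents then agree. Marking is proved with Laplace
functionals, which characterize Poisson processes. Uniqueness of Q holds because the law of the
counts determines the intensity, and {0} × [0,1] × A isolates Q(A). -/

noncomputable section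

namespace BrownResnick

/-! ### The function `x ↦ e^{-x}` on `[0, ∞]` -/

/-- The function `x ↦ e^{-x}` on `[0, ∞]`. -/
def expNeg (x : ENNReal) : ENNReal := EReal.exp (-(x : EReal))

@[simp] lemma expNeg_zero : expNeg 0 = 1 := by simp [expNeg]

@[simp] lemma expNeg_top : expNeg ⊤ = 0 := by simp [expNeg]

lemma expNeg_add (x y : ENNReal) : expNeg (x + y) = expNeg x * expNeg y := by
  rw [expNeg, expNeg, expNeg, ← EReal.exp_add, EReal.coe_ennreal_add, EReal.neg_add, sub_eq_add_neg]
  · exact Or.inl (EReal.coe_ennreal_ne_bot _)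
  · exact Or.inr (EReal.coe_ennreal_ne_bot _)

lemma expNeg_le_one (x : ENNReal) : expNeg x ≤ 1 := by
  rw [expNeg, EReal.exp_le_one_iff, EReal.neg_le, neg_zero]
  exact EReal.coe_ennreal_nonneg x

lemma expNeg_ne_top (x : ENNReal) : expNeg x ≠ ⊤ :=
  ((expNeg_le_one x).trans_lt ENNReal.one_lt_top).ne

lemma continuous_expNeg : Continuous expNeg :=
  ENNReal.continuous_exp.comp (continuous_neg.comp continuous_coe_ennreal_ereal)

lemma measurable_expNeg : Measurable expNeg := continuous_expNeg.measurable

lemma expNeg_injective : Function.Injective expNeg := fun x y h ↦ by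
  have := EReal.exp_strictMono.injective h
  simpa using this

lemma expNeg_antitone : Antitone expNeg := fun x y h ↦ by
  refine EReal.exp_monotone ?_
  simpa using h

lemma expNeg_sum {ι : Type*} (s : Finset ι) (f : ι → ENNReal) :
    expNeg (∑ i ∈ s, f i) = ∏ i ∈ s, expNeg (f i) := by
  induction s using Finset.cons_induction with
  | empty => simp
  | cons i s hi ih => rw [Finset.sum_cons, Finset.prod_cons, expNeg_add, ih]

lemma expNeg_nat_mul (n : ℕ) (x : ENNReal) : expNeg (n * x) = expNeg x ^ n := by
  induction n with
  | zero => simp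
  | succ n ih => rw [Nat.cast_succ, add_mul, one_mul, expNeg_add, ih, pow_succ]

lemma expNeg_ofReal {r : ℝ} (hr : 0 ≤ r) :
    expNeg (ENNReal.ofReal r) = ENNReal.ofReal (Real.exp (-r)) := by
  rw [expNeg, EReal.coe_ennreal_ofReal, max_eq_left hr, ← EReal.coe_neg, EReal.exp_coe]

lemma expNeg_eq_one_iff {x : ENNReal} : expNeg x = 1 ↔ x = 0 := by
  rw [← expNeg_zero, expNeg_injective.eq_iff]

/-- A right inverse of `expNeg` on `[0, 1]`. -/
def negLog (g : ENNReal) : ENNReal := (-ENNReal.log g).toENNReal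

lemma measurable_negLog : Measurable negLog :=
  measurable_ereal_toENNReal.comp (continuous_neg.measurable.comp ENNReal.measurable_log)

lemma expNeg_negLog {g : ENNReal} (hg : g ≤ 1) : expNeg (negLog g) = g := by
  rw [expNeg, negLog, EReal.coe_toENNReal, neg_neg, ENNReal.exp_log]
  rw [EReal.le_neg]
  simpa using hg

lemma tendsto_prod_expNeg (f : ℕ → ENNReal) :
    Tendsto (fun n ↦ ∏ i ∈ Finset.range n, expNeg (f i)) atTop (𝓝 (expNeg (∑' i, f i))) := by
  simp_rw [← expNeg_sum]
  exact (continuous_expNeg.tendsto _).comp (ENNReal.tendsto_nat_tsum f)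

/-! ### Laplace transforms determine laws on `[0, ∞]^n` -/

/-- The monomial `x ↦ ∏ j, e^{-k_j x_j}` as a bounded continuous function on `[0, ∞]^n`. -/
def expMonomial {n : ℕ} (k : Fin n → ℕ) :
    BoundedContinuousFunction (Fin n → ENNReal) ℝ :=
  BoundedContinuousFunction.mkOfCompact
    ⟨fun x ↦ ∏ j, (expNeg (x j)).toReal ^ k j, by
      refine continuous_finsetProd _ fun j _ ↦ Continuous.pow ?_ _
      exact ENNReal.continuousOn_toReal.comp_continuous
        (continuous_expNeg.comp (continuous_apply j)) fun x ↦ expNeg_ne_top _⟩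

lemma expMonomial_apply {n : ℕ} (k : Fin n → ℕ) (x : Fin n → ENNReal) :
    expMonomial k x = ∏ j, (expNeg (x j)).toReal ^ k j := rfl

/-- The monomials `expMonomial k` as a submonoid. -/
def expMonomialSubmonoid (n : ℕ) :
    Submonoid (BoundedContinuousFunction (Fin n → ENNReal) ℝ) where
  carrier := Set.range expMonomial
  one_mem' := ⟨0, by ext x; simp [expMonomial_apply]⟩
  mul_mem' := by
    rintro _ _ ⟨k, rfl⟩ ⟨l, rfl⟩
    refine ⟨k + l, ?_⟩
    ext x
    simp [expMonomial_apply, pow_add, Finset.prod_mul_distrib]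

/-- The algebra spanned by the monomials `expMonomial k`. -/
def expMonomialAlgebra (n : ℕ) :
    StarSubalgebra ℝ (BoundedContinuousFunction (Fin n → ENNReal) ℝ) where
  toSubalgebra := Algebra.adjoin ℝ (expMonomialSubmonoid n : Set _)
  star_mem' := fun {a} ha ↦ by
    have : star a = a := by
      ext x
      simp
    rwa [this]

lemma mem_expMonomialAlgebra {n : ℕ} {f : BoundedContinuousFunction (Fin n → ENNReal) ℝ} :
    f ∈ expMonomialAlgebra n ↔ f ∈ Submodule.span ℝ (Set.range (expMonomial (n := n))) := by
  change f ∈ Subalgebra.toSubmodule (Algebra.adjoin ℝ (expMonomialSubmonoid n : Set _)) ↔ _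
  rw [Algebra.adjoin_eq_span, Submonoid.closure_eq]
  rfl

/-- Stone–Weierstrass: the monomials in e^{-x_j} span an algebra that separates the points of
[0,∞]^n. Counts may be infinite, so ∞ is kept in the state space. -/
lemma measure_ext_of_lintegral_expNeg {n : ℕ} {μ ν : Measure (Fin n → ENNReal)}
    [IsProbabilityMeasure μ] [IsProbabilityMeasure ν]
    (h : ∀ k : Fin n → ℕ,
      ∫⁻ x, ∏ j, expNeg (k j * x j) ∂μ = ∫⁻ x, ∏ j, expNeg (k j * x j) ∂ν) : μ = ν := by
  have key : ∀ (ρ : Measure (Fin n → ENNReal)) (k : Fin n → ℕ),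
      ∫ x, expMonomial k x ∂ρ = (∫⁻ x, ∏ j, expNeg (k j * x j) ∂ρ).toReal := by
    intro ρ k
    rw [← integral_toReal]
    · congr with x
      simp [expMonomial_apply, expNeg_nat_mul, ENNReal.toReal_prod]
    · refine Measurable.aemeasurable ?_
      exact Finset.measurable_fun_prod _ fun j _ ↦
        measurable_expNeg.comp ((measurable_pi_apply j).const_mul _)
    · refine ae_of_all _ fun x ↦ ENNReal.prod_lt_top fun j _ ↦ (expNeg_ne_top _).lt_top
  refine ext_of_forall_mem_subalgebra_integral_eq_of_polish (𝕜 := ℝ) (A := expMonomialAlgebra n) ?_ ?_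
  · intro x y hxy
    obtain ⟨j, hj⟩ := Function.ne_iff.1 hxy
    have hmem : expMonomial (Pi.single j 1) ∈ expMonomialAlgebra n :=
      mem_expMonomialAlgebra.2 (Submodule.subset_span ⟨_, rfl⟩)
    have hv : ∀ z : Fin n → ENNReal,
        expMonomial (Pi.single j 1) z = (expNeg (z j)).toReal := by
      intro z
      rw [expMonomial_apply, Finset.prod_eq_single j]
      · simp
      · intro i _ hi
        simp [hi]
      · simp
    refine ⟨expMonomial (Pi.single j 1), ⟨BoundedContinuousFunction.toContinuousMapStarₐ ℝ
      (expMonomial (Pi.single j 1)), ⟨_, hmem, rfl⟩, rfl⟩, fun he ↦ ?_⟩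
    replace he : expMonomial (Pi.single j 1) x = expMonomial (Pi.single j 1) y := he
    rw [hv, hv] at he
    rw [ENNReal.toReal_eq_toReal_iff' (expNeg_ne_top _) (expNeg_ne_top _)] at he
    exact hj (expNeg_injective he)
  · intro g hg
    rw [mem_expMonomialAlgebra] at hg
    induction hg using Submodule.span_induction with
    | mem f hf =>
      obtain ⟨k, rfl⟩ := hf
      rw [key, key, h]
    | zero => simp
    | add f g hf hg hf' hg' =>
      simp only [BoundedContinuousFunction.coe_add, Pi.add_apply]
      rw [integral_add (f.integrable _) (g.integrable _),
        integral_add (f.integrable _) (g.integrable _), hf', hg']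
    | smul c f hf hf' =>
      simp only [BoundedContinuousFunction.coe_smul]
      rw [integral_smul, integral_smul, hf']

/-! ### The Poisson law on `[0, ∞]` -/

instance (m : ENNReal) : IsProbabilityMeasure (poissonLaw m) := by
  unfold poissonLaw
  split_ifs
  · infer_instance
  · exact Measure.isProbabilityMeasure_map (Measurable.of_discrete).aemeasurable

lemma lintegral_expNeg_poissonLaw (m c : ENNReal) :
    ∫⁻ x, expNeg (c * x) ∂poissonLaw m = expNeg ((1 - expNeg c) * m) := by
  have hmeas : Measurable fun x ↦ expNeg (c * x) := measurable_expNeg.comp (measurable_const_mul c)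
  unfold poissonLaw
  split_ifs with hm
  · rw [lintegral_dirac' _ hmeas, hm]
    -- For infinite mean the formula relies on 0 · ∞ = 0 at c = 0; for c > 0 both sides vanish.
    rcases eq_or_ne c 0 with rfl | hc
    · simp
    · have : 1 - expNeg c ≠ 0 := by
        rw [Ne, tsub_eq_zero_iff_le, not_le]
        exact lt_of_le_of_ne (expNeg_le_one c) (mt expNeg_eq_one_iff.1 hc)
      rw [ENNReal.mul_top hc, ENNReal.mul_top this]
  · lift m to NNReal using hm
    rw [lintegral_map hmeas .of_discrete, lintegral_countable']
    have hz : expNeg c = ENNReal.ofReal (expNeg c).toReal := by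
      rw [ENNReal.ofReal_toReal (expNeg_ne_top c)]
    have hz1 : (expNeg c).toReal ≤ 1 := by
      simpa using ENNReal.toReal_mono ENNReal.one_ne_top (expNeg_le_one c)
    set z := (expNeg c).toReal with hzdef
    have hz0 : 0 ≤ z := ENNReal.toReal_nonneg
    have hterm : ∀ k : ℕ, expNeg (c * (k : ENNReal)) * poissonMeasure m {k}
        = ENNReal.ofReal (Real.exp (-m) * ((z * m) ^ k / k.factorial)) := by
      intro k
      rw [mul_comm c, expNeg_nat_mul, hz, poissonMeasure_singleton, ← ENNReal.ofReal_pow hz0,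
        ← ENNReal.ofReal_mul (by positivity)]
      congr 1
      ring
    simp only [ENNReal.toNNReal_coe]
    simp_rw [hterm]
    have hs : HasSum (fun k : ℕ ↦ Real.exp (-m) * ((z * m) ^ k / k.factorial))
        (Real.exp (-m) * Real.exp (z * m)) := by
      rw [Real.exp_eq_exp_ℝ]
      exact (NormedSpace.expSeries_div_hasSum_exp (z * (m : ℝ))).mul_left _
    rw [← ENNReal.ofReal_tsum_of_nonneg (fun k ↦ by positivity) hs.summable, hs.tsum_eq,
      ← Real.exp_add, hz, ← ENNReal.ofReal_one, ← ENNReal.ofReal_sub _ hz0,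
      ← ENNReal.ofReal_coe_nnreal, ← ENNReal.ofReal_mul (by linarith),
      expNeg_ofReal (r := (1 - z) * m) (mul_nonneg (by linarith) m.2)]
    congr 2
    ring

/-- At c = ∞ the Laplace transform is the probability of the value 0, namely e^{-m}. -/
lemma poissonLaw_injective : Function.Injective poissonLaw := by
  intro m m' h
  have h1 := lintegral_expNeg_poissonLaw m ⊤
  have h2 := lintegral_expNeg_poissonLaw m' ⊤
  rw [h, h2] at h1
  simpa using (expNeg_injective h1).symm

/-! ### Laplace functionals of Poisson point processes -/

section Poisson

variable {Ω S S' : Type*} [MeasurableSpace Ω] [MeasurableSpace S] [MeasurableSpace S']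
  {P : Measure Ω} {Y : ℕ → Ω → S} {μ : Measure S}

omit [MeasurableSpace Ω] in
lemma lintegral_pointMeasure (Y : ℕ → Ω → S) {f : S → ENNReal} (hf : Measurable f) (ω : Ω) :
    ∫⁻ x, f x ∂pointMeasure Y ω = ∑' i, f (Y i ω) := by
  rw [pointMeasure, lintegral_sum_measure]
  simp_rw [lintegral_dirac' _ hf]

lemma measurable_lintegral_pointMeasure (hY : ∀ i, Measurable (Y i)) {f : S → ENNReal}
    (hf : Measurable f) : Measurable fun ω ↦ ∫⁻ x, f x ∂pointMeasure Y ω := by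
  simp_rw [lintegral_pointMeasure Y hf]
  exact Measurable.tsum fun i ↦ hf.comp (hY i)

lemma measurable_pointMeasure (hY : ∀ i, Measurable (Y i)) {A : Set S} (hA : MeasurableSet A) :
    Measurable fun ω ↦ pointMeasure Y ω A := by
  simpa [lintegral_indicator_one hA] using
    measurable_lintegral_pointMeasure hY (f := A.indicator 1) (measurable_one.indicator hA)

/-- The fibres of a simple function are disjoint, so their counts are independent and the
expectation factors into Poisson Laplace transforms. -/
lemma IsPoissonPointProcess.laplace_simpleFunc (h : IsPoissonPointProcess Y μ P)
    (hY : ∀ i, Measurable (Y i)) (f : SimpleFunc S ENNReal) :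
    ∫⁻ ω, expNeg (∫⁻ x, f x ∂pointMeasure Y ω) ∂P = expNeg (∫⁻ x, 1 - expNeg (f x) ∂μ) := by
  let e := f.range.equivFin.symm
  let A : Fin _ → Set S := fun j ↦ f ⁻¹' {(e j : ENNReal)}
  have hA : ∀ j, MeasurableSet (A j) := fun j ↦ f.measurableSet_fiber _
  have hdisj : Pairwise fun j k ↦ Disjoint (A j) (A k) := by
    intro j k hjk
    refine Disjoint.preimage _ ?_
    rw [Set.disjoint_singleton]
    exact fun hh ↦ hjk (e.injective (Subtype.ext hh))
  have hind := h.indep _ A hA hdisj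
  have hmul : ∀ c : ENNReal, Measurable fun x : ENNReal ↦ expNeg (c * x) := fun c ↦
    measurable_expNeg.comp (measurable_const_mul c)
  have hsum : ∀ (F : ENNReal → ENNReal → ENNReal) (ρ : Measure S),
      ∑ c ∈ f.range, F c (ρ (f ⁻¹' {c})) = ∑ j, F (e j) (ρ (A j)) := by
    intro F ρ
    rw [← Finset.sum_coe_sort, ← e.sum_comp]
  have h1 : ∀ ω, expNeg (∫⁻ x, f x ∂pointMeasure Y ω)
      = ∏ j, expNeg (e j * pointMeasure Y ω (A j)) := by
    intro ω
    rw [SimpleFunc.lintegral_eq_lintegral, SimpleFunc.lintegral, hsum (fun c m ↦ c * m),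
      expNeg_sum]
  have h2 : ∫⁻ x, 1 - expNeg (f x) ∂μ = ∑ j, (1 - expNeg (e j)) * μ (A j) := by
    have := (f.map fun c ↦ 1 - expNeg c).lintegral_eq_lintegral μ
    rw [SimpleFunc.map_lintegral, hsum (fun c m ↦ (1 - expNeg c) * m)] at this
    exact this
  simp_rw [h1]
  rw [lintegral_prod_eq_prod_lintegral_of_indepFun Finset.univ
    (fun j ω ↦ expNeg (e j * pointMeasure Y ω (A j)))
    (hind.comp (fun j x ↦ expNeg (e j * x)) fun j ↦ hmul _)
    (fun j ↦ (hmul _).comp (measurable_pointMeasure hY (hA j))), h2, expNeg_sum]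
  refine Finset.prod_congr rfl fun j _ ↦ ?_
  rw [← lintegral_expNeg_poissonLaw, ← (h.hasLaw (A j) (hA j)).map_eq,
    lintegral_map (hmul _) (measurable_pointMeasure hY (hA j))]

/-- The Laplace functional of a Poisson point process. -/
lemma IsPoissonPointProcess.laplace [IsProbabilityMeasure P] (h : IsPoissonPointProcess Y μ P)
    (hY : ∀ i, Measurable (Y i)) {f : S → ENNReal} (hf : Measurable f) :
    ∫⁻ ω, expNeg (∫⁻ x, f x ∂pointMeasure Y ω) ∂P = expNeg (∫⁻ x, 1 - expNeg (f x) ∂μ) := by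
  have hmono : ∀ x, Monotone fun n ↦ SimpleFunc.eapprox f n x := fun x m n hmn ↦
    SimpleFunc.monotone_eapprox f hmn x
  have hlim : ∀ x, Tendsto (fun n ↦ SimpleFunc.eapprox f n x) atTop (𝓝 (f x)) := fun x ↦ by
    rw [← SimpleFunc.iSup_eapprox_apply hf x]
    exact tendsto_atTop_iSup (hmono x)
  have hL : Tendsto
      (fun n ↦ ∫⁻ ω, expNeg (∫⁻ x, SimpleFunc.eapprox f n x ∂pointMeasure Y ω) ∂P) atTop
      (𝓝 (∫⁻ ω, expNeg (∫⁻ x, f x ∂pointMeasure Y ω) ∂P)) := by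
    refine tendsto_lintegral_of_dominated_convergence (fun _ ↦ 1) (fun n ↦ ?_)
      (fun n ↦ ae_of_all _ fun ω ↦ expNeg_le_one _) (by simp) (ae_of_all _ fun ω ↦ ?_)
    · exact measurable_expNeg.comp
        (measurable_lintegral_pointMeasure hY (SimpleFunc.eapprox f n).measurable)
    · exact (continuous_expNeg.tendsto _).comp (lintegral_tendsto_of_tendsto_of_monotone
        (fun n ↦ (SimpleFunc.eapprox f n).measurable.aemeasurable) (ae_of_all _ hmono)
        (ae_of_all _ hlim))
  have hR : Tendsto (fun n ↦ expNeg (∫⁻ x, 1 - expNeg (SimpleFunc.eapprox f n x) ∂μ)) atTop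
      (𝓝 (expNeg (∫⁻ x, 1 - expNeg (f x) ∂μ))) := by
    refine (continuous_expNeg.tendsto _).comp (lintegral_tendsto_of_tendsto_of_monotone
      (fun n ↦ ?_) (ae_of_all _ fun x m n hmn ↦ ?_) (ae_of_all _ fun x ↦ ?_))
    · exact ((measurable_expNeg.comp (SimpleFunc.eapprox f n).measurable).const_sub 1).aemeasurable
    · exact tsub_le_tsub_left (expNeg_antitone (hmono x hmn)) 1
    · exact ENNReal.Tendsto.sub tendsto_const_nhds
        ((continuous_expNeg.tendsto _).comp (hlim x)) (Or.inl ENNReal.one_ne_top)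
  refine tendsto_nhds_unique hL ?_
  simp_rw [h.laplace_simpleFunc hY]
  exact hR

/-- A point process with the Laplace functional of a Poisson point process is one. -/
lemma IsPoissonPointProcess.of_laplace [IsProbabilityMeasure P] (hY : ∀ i, Measurable (Y i))
    (h : ∀ f : S → ENNReal, Measurable f →
      ∫⁻ ω, expNeg (∫⁻ x, f x ∂pointMeasure Y ω) ∂P = expNeg (∫⁻ x, 1 - expNeg (f x) ∂μ)) :
    IsPoissonPointProcess Y μ P := by
  have key : ∀ (n : ℕ) (A : Fin n → Set S), (∀ j, MeasurableSet (A j)) →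
      Pairwise (fun j k ↦ Disjoint (A j) (A k)) →
      P.map (fun ω j ↦ pointMeasure Y ω (A j)) = Measure.pi fun j ↦ poissonLaw (μ (A j)) := by
    intro n A hA hdisj
    have hm : Measurable fun ω j ↦ pointMeasure Y ω (A j) :=
      measurable_pi_lambda _ fun j ↦ measurable_pointMeasure hY (hA j)
    have := Measure.isProbabilityMeasure_map (μ := P) hm.aemeasurable
    have hmul : ∀ c : ENNReal, Measurable fun x : ENNReal ↦ expNeg (c * x) := fun c ↦
      measurable_expNeg.comp (measurable_const_mul c)
    -- The joint Laplace transform of the counts at k is the Laplace functional of ∑ k_j 1_{A_j}.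
    refine measure_ext_of_lintegral_expNeg fun k ↦ ?_
    have hfm : ∀ c : Fin n → ENNReal, ∀ j, Measurable ((A j).indicator fun _ ↦ c j) :=
      fun c j ↦ measurable_const.indicator (hA j)
    have hint : ∀ (c : Fin n → ENNReal) (ρ : Measure S),
        ∫⁻ x, ∑ j, (A j).indicator (fun _ ↦ c j) x ∂ρ = ∑ j, c j * ρ (A j) := by
      intro c ρ
      rw [lintegral_finsetSum _ fun j _ ↦ hfm c j]
      simp_rw [lintegral_indicator_const (hA _)]
    -- By disjointness at most one term of the sum is nonzero, which makes 1 - e^{-·} additive here.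
    have hpt : ∀ x, 1 - expNeg (∑ j, (A j).indicator (fun _ ↦ (k j : ENNReal)) x)
        = ∑ j, (A j).indicator (fun _ ↦ 1 - expNeg (k j : ENNReal)) x := by
      intro x
      by_cases hx : ∃ j, x ∈ A j
      · obtain ⟨j, hj⟩ := hx
        have hne : ∀ i, i ≠ j → x ∉ A i := fun i hi hxi ↦
          Set.disjoint_left.1 (hdisj hi) hxi hj
        rw [Finset.sum_eq_single j (fun i _ hi ↦ Set.indicator_of_notMem (hne i hi) _) (by simp),
          Finset.sum_eq_single j (fun i _ hi ↦ Set.indicator_of_notMem (hne i hi) _) (by simp),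
          Set.indicator_of_mem hj, Set.indicator_of_mem hj]
      · push Not at hx
        simp [hx]
    have hprod : Measurable fun x : Fin n → ENNReal ↦ ∏ j, expNeg (k j * x j) :=
      Finset.measurable_fun_prod _ fun j _ ↦ (hmul _).comp (measurable_pi_apply j)
    rw [lintegral_map hprod hm]
    rw [lintegral_prod_eq_prod_lintegral_of_indepFun (μ := Measure.pi _) Finset.univ
      (fun j (x : Fin n → ENNReal) ↦ expNeg (k j * x j))
      (iIndepFun_pi fun j ↦ (hmul (k j)).aemeasurable)
      (fun j ↦ (hmul _).comp (measurable_pi_apply j))]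
    have hl := h (fun x ↦ ∑ j, (A j).indicator (fun _ ↦ (k j : ENNReal)) x)
      (Finset.measurable_fun_sum _ fun j _ ↦ hfm (fun j ↦ (k j : ENNReal)) j)
    simp_rw [hint (fun j ↦ (k j : ENNReal)), hpt] at hl
    rw [hint (fun j ↦ 1 - expNeg (k j : ENNReal))] at hl
    simp_rw [expNeg_sum] at hl
    rw [hl]
    refine Finset.prod_congr rfl fun j _ ↦ ?_
    rw [← lintegral_expNeg_poissonLaw]
    exact ((measurePreserving_eval (fun j ↦ poissonLaw (μ (A j))) j).lintegral_comp
      (hmul (k j))).symm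
  have hlaw : ∀ A, MeasurableSet A →
      HasLaw (fun ω ↦ pointMeasure Y ω A) (poissonLaw (μ A)) P := by
    intro A hA
    refine ⟨(measurable_pointMeasure hY hA).aemeasurable, ?_⟩
    have h1 := key 1 (fun _ ↦ A) (fun _ ↦ hA) (fun j k hjk ↦ (hjk (Subsingleton.elim _ _)).elim)
    rw [← (measurePreserving_eval (fun _ : Fin 1 ↦ poissonLaw (μ A)) 0).map_eq, ← h1,
      Measure.map_map (measurable_pi_apply _)
        (measurable_pi_lambda _ fun _ ↦ measurable_pointMeasure hY hA)]
    rfl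
  refine ⟨hlaw, fun n A hA hdisj ↦ ?_⟩
  rw [iIndepFun_iff_map_fun_eq_pi_map fun j ↦ (measurable_pointMeasure hY (hA j)).aemeasurable,
    key n A hA hdisj]
  congr with j : 1
  rw [(hlaw _ (hA j)).map_eq]

omit [MeasurableSpace Ω] in
lemma pointMeasure_map {g : S → S'} (hg : Measurable g) (ω : Ω) {A : Set S'}
    (hA : MeasurableSet A) :
    pointMeasure (fun i ω ↦ g (Y i ω)) ω A = pointMeasure Y ω (g ⁻¹' A) := by
  rw [pointMeasure, pointMeasure, Measure.sum_apply _ hA, Measure.sum_apply _ (hg hA)]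
  simp_rw [Measure.dirac_apply' _ hA, Measure.dirac_apply' _ (hg hA)]
  rfl

/-- The mapping theorem for Poisson point processes. -/
lemma IsPoissonPointProcess.map (h : IsPoissonPointProcess Y μ P) {g : S → S'}
    (hg : Measurable g) : IsPoissonPointProcess (fun i ω ↦ g (Y i ω)) (μ.map g) P where
  hasLaw A hA := by
    simp_rw [pointMeasure_map hg _ hA, Measure.map_apply hg hA]
    exact h.hasLaw _ (hg hA)
  indep n A hA hdisj := by
    simp_rw [pointMeasure_map hg _ (hA _)]
    exact h.indep n _ (fun j ↦ hg (hA j)) fun j k hjk ↦ (hdisj hjk).preimage g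

/-- The intensity measure of a Poisson point process is unique. -/
lemma IsPoissonPointProcess.intensity_unique {μ' : Measure S} (h : IsPoissonPointProcess Y μ P)
    (h' : IsPoissonPointProcess Y μ' P) : μ = μ' := by
  ext A hA
  exact poissonLaw_injective ((h.hasLaw A hA).map_eq.symm.trans (h'.hasLaw A hA).map_eq)

/-- The expectation of a product over independently marked points. -/
lemma lintegral_prod_mark [IsProbabilityMeasure P] {X : ℕ → Ω → S} {Z : ℕ → Ω → S'}
    {ν : Measure S'} (hX : ∀ i, Measurable (X i)) (hZ : ∀ i, Measurable (Z i))
    (hlaw : ∀ i, P.map (Z i) = ν) (hind : iIndepFun Z P)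
    (hXZ : IndepFun (fun ω i ↦ X i ω) (fun ω i ↦ Z i ω) P)
    {φ : S × S' → ENNReal} (hφ : Measurable φ) (n : ℕ) :
    ∫⁻ ω, ∏ i ∈ Finset.range n, φ (X i ω, Z i ω) ∂P
      = ∫⁻ ω, ∏ i ∈ Finset.range n, ∫⁻ z, φ (X i ω, z) ∂ν ∂P := by
  have hXm : Measurable fun ω i ↦ X i ω := measurable_pi_lambda _ hX
  have hZm : Measurable fun ω i ↦ Z i ω := measurable_pi_lambda _ hZ
  have : SFinite ν := by
    rw [← hlaw 0]
    infer_instance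
  have hF : Measurable fun q : (ℕ → S) × (ℕ → S') ↦
      ∏ i ∈ Finset.range n, φ (q.1 i, q.2 i) :=
    Finset.measurable_fun_prod _ fun i _ ↦ hφ.comp
      (((measurable_pi_apply i).comp measurable_fst).prodMk
        ((measurable_pi_apply i).comp measurable_snd))
  -- By Fubini the unmarked points can be frozen while the independent marks are integrated out.
  have hprod := (indepFun_iff_map_prod_eq_prod_map_map hXm.aemeasurable hZm.aemeasurable).1 hXZ
  have h1 : ∫⁻ ω, ∏ i ∈ Finset.range n, φ (X i ω, Z i ω) ∂P
      = ∫⁻ q, ∏ i ∈ Finset.range n, φ (q.1 i, q.2 i)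
        ∂(P.map fun ω ↦ ((fun i ↦ X i ω), (fun i ↦ Z i ω))) := by
    rw [lintegral_map hF (hXm.prodMk hZm)]
  rw [h1, hprod, lintegral_prod _ hF.aemeasurable, lintegral_map hF.lintegral_prod_right' hXm]
  refine lintegral_congr fun ω ↦ ?_
  have hsec : ∀ i, Measurable fun z ↦ φ (X i ω, z) := fun i ↦
    hφ.comp (measurable_const.prodMk measurable_id)
  have hFω : Measurable fun z : ℕ → S' ↦ ∏ i ∈ Finset.range n, φ (X i ω, z i) :=
    Finset.measurable_fun_prod _ fun i _ ↦ (hsec i).comp (measurable_pi_apply i)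
  rw [lintegral_map hFω hZm]
  rw [lintegral_prod_eq_prod_lintegral_of_indepFun _ (fun i ω' ↦ φ (X i ω, Z i ω'))
    (hind.comp (fun i z ↦ φ (X i ω, z)) hsec) fun i ↦ (hsec i).comp (hZ i)]
  refine Finset.prod_congr rfl fun i _ ↦ ?_
  rw [← hlaw i, lintegral_map (hsec i) (hZ i)]

/-- The marking theorem for Poisson point processes. -/
lemma IsPoissonPointProcess.mark [IsProbabilityMeasure P] {X : ℕ → Ω → S} {Z : ℕ → Ω → S'}
    {ν : Measure S'} (h : IsPoissonPointProcess X μ P) (hX : ∀ i, Measurable (X i))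
    (hZ : ∀ i, Measurable (Z i)) (hlaw : ∀ i, P.map (Z i) = ν) (hind : iIndepFun Z P)
    (hXZ : IndepFun (fun ω i ↦ X i ω) (fun ω i ↦ Z i ω) P) :
    IsPoissonPointProcess (fun i ω ↦ (X i ω, Z i ω)) (μ.prod ν) P := by
  have hν : IsProbabilityMeasure ν := by
    rw [← hlaw 0]
    exact Measure.isProbabilityMeasure_map (hZ 0).aemeasurable
  have hXZm : ∀ i, Measurable fun ω ↦ (X i ω, Z i ω) := fun i ↦ (hX i).prodMk (hZ i)
  refine .of_laplace hXZm fun f hf ↦ ?_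
  have hφ : Measurable fun q ↦ expNeg (f q) := measurable_expNeg.comp hf
  -- Averaging e^{-f} over the mark gives g ≤ 1, so g = e^{-h} with h = -log g, a test function on
  -- the unmarked space.
  let g : S → ENNReal := fun x ↦ ∫⁻ z, expNeg (f (x, z)) ∂ν
  have hg : Measurable g := hφ.lintegral_prod_right'
  have hg1 : ∀ x, g x ≤ 1 := fun x ↦
    (lintegral_mono fun z ↦ expNeg_le_one _).trans (by simp)
  have hgm : Measurable fun x ↦ negLog (g x) := measurable_negLog.comp hg
  have hgl : ∀ x, expNeg (negLog (g x)) = g x := fun x ↦ expNeg_negLog (hg1 x)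
  have hL : Tendsto (fun n ↦ ∫⁻ ω, ∏ i ∈ Finset.range n, expNeg (f (X i ω, Z i ω)) ∂P) atTop
      (𝓝 (∫⁻ ω, expNeg (∫⁻ x, f x ∂pointMeasure (fun i ω ↦ (X i ω, Z i ω)) ω) ∂P)) := by
    refine tendsto_lintegral_of_dominated_convergence (fun _ ↦ 1) (fun n ↦ ?_)
      (fun n ↦ ae_of_all _ fun ω ↦ ?_) (by simp) (ae_of_all _ fun ω ↦ ?_)
    · exact Finset.measurable_fun_prod _ fun i _ ↦ hφ.comp (hXZm i)
    · exact Finset.prod_le_one' fun i _ ↦ expNeg_le_one _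
    · rw [lintegral_pointMeasure _ hf]
      exact tendsto_prod_expNeg _
  have hR : Tendsto (fun n ↦ ∫⁻ ω, ∏ i ∈ Finset.range n, g (X i ω) ∂P) atTop
      (𝓝 (∫⁻ ω, expNeg (∫⁻ x, negLog (g x) ∂pointMeasure X ω) ∂P)) := by
    refine tendsto_lintegral_of_dominated_convergence (fun _ ↦ 1) (fun n ↦ ?_)
      (fun n ↦ ae_of_all _ fun ω ↦ ?_) (by simp) (ae_of_all _ fun ω ↦ ?_)
    · exact Finset.measurable_fun_prod _ fun i _ ↦ hg.comp (hX i)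
    · exact Finset.prod_le_one' fun i _ ↦ hg1 _
    · rw [lintegral_pointMeasure _ hgm]
      simpa only [hgl] using tendsto_prod_expNeg fun i ↦ negLog (g (X i ω))
  simp_rw [lintegral_prod_mark hX hZ hlaw hind hXZ hφ] at hL
  rw [tendsto_nhds_unique hL hR, h.laplace hX hgm,
    lintegral_prod _ (hφ.const_sub 1).aemeasurable]
  congr 1
  refine lintegral_congr fun x ↦ ?_
  have hsec : Measurable fun z ↦ expNeg (f (x, z)) :=
    hφ.comp (measurable_const.prodMk measurable_id)
  rw [hgl, lintegral_sub hsec ((hg1 x).trans_lt ENNReal.one_lt_top).ne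
    (ae_of_all _ fun z ↦ expNeg_le_one _)]
  simp [g]

end Poisson

/-! ### Measures with the same moment generating function -/

/-- Along each linear functional the moment generating function is finite everywhere, so it extends
analytically to the complex plane; its value at i is the characteristic function. Integrability
under ν is automatic: otherwise the integral would be 0 by convention, but the one under μ is
positive. -/
lemma measure_pi_ext_of_integral_exp {ι : Type*} [Fintype ι] {μ ν : Measure (ι → ℝ)}
    [IsProbabilityMeasure μ] [IsFiniteMeasure ν]
    (hμ : ∀ a : ι → ℝ, Integrable (fun x ↦ Real.exp (∑ i, a i * x i)) μ)
    (h : ∀ a : ι → ℝ, ∫ x, Real.exp (∑ i, a i * x i) ∂μ = ∫ x, Real.exp (∑ i, a i * x i) ∂ν) :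
    μ = ν := by
  classical
  refine Measure.ext_of_charFunDual ?_
  ext L
  have hL : ∀ (z : ℝ) (x : ι → ℝ), z * L x = ∑ i, (z * L (Pi.single i 1)) * x i := by
    intro z x
    have hx : x = ∑ i, x i • (Pi.single i 1 : ι → ℝ) := by
      ext j
      simp [Finset.sum_apply, Pi.single_apply]
    conv_lhs => rw [hx, map_sum, Finset.mul_sum]
    refine Finset.sum_congr rfl fun i _ ↦ ?_
    rw [map_smul, smul_eq_mul]
    ring
  have hexp : ∀ z : ℝ, (fun x ↦ Real.exp (z * L x))
      = fun x ↦ Real.exp (∑ i, (z * L (Pi.single i 1)) * x i) := fun z ↦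
    funext fun x ↦ congrArg Real.exp (hL z x)
  have hmgf : mgf L μ = mgf L ν := by
    ext z
    rw [mgf, mgf, hexp]
    exact h _
  have huniv : integrableExpSet L μ = Set.univ := by
    refine Set.eq_univ_of_forall fun z ↦ ?_
    change Integrable _ μ
    rw [hexp]
    exact hμ _
  have hc := eqOn_complexMGF_of_mgf hmgf (x := Complex.I) (by simp [huniv])
  simpa [charFunDual, complexMGF, mul_comm, BoundedContinuousFunction.probCharDual_apply] using hc

/-! ### The Cameron–Martin shift of a Gaussian process with stationary increments -/

section Shift

variable {T Ω : Type*} [MeasurableSpace Ω] {P : Measure Ω} {W : T → Ω → ℝ}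

/-- Exponential moments of linear combinations of a centred Gaussian process. -/
lemma integral_exp_linearCombination (hW : IsGaussianProcess W P)
    (hmean : ∀ t, ∫ ω, W t ω ∂P = 0) {ι : Type*} [Fintype ι] (f : ι → T) (b : ι → ℝ) :
    Integrable (fun ω ↦ Real.exp (∑ i, b i * W (f i) ω)) P ∧
      ∫ ω, Real.exp (∑ i, b i * W (f i) ω) ∂P
        = Real.exp ((∑ i, ∑ j, b i * b j * cov[W (f i), W (f j); P]) / 2) := by
  have := hW.isProbabilityMeasure
  have hG : HasGaussianLaw (fun ω ↦ ∑ i, b i * W (f i) ω) P :=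
    ((hW.comp_right f).smul b).hasGaussianLaw_fun_sum (I := Finset.univ)
  have hL2 : ∀ i, MemLp (fun ω ↦ b i * W (f i) ω) 2 P := fun i ↦
    ((hW.hasGaussianLaw_eval (f i)).memLp_two).const_mul (b i)
  have hmean0 : ∫ ω, ∑ i, b i * W (f i) ω ∂P = 0 := by
    rw [integral_finsetSum _ fun i _ ↦ (hL2 i).integrable one_le_two]
    simp [integral_const_mul, hmean]
  have hvar : Var[fun ω ↦ ∑ i, b i * W (f i) ω; P]
      = ∑ i, ∑ j, b i * b j * cov[W (f i), W (f j); P] := by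
    have := variance_fun_sum (fun i ↦ hL2 i)
    rw [this]
    refine Finset.sum_congr rfl fun i _ ↦ Finset.sum_congr rfl fun j _ ↦ ?_
    rw [covariance_const_mul_left, covariance_const_mul_right]
    ring
  have hmap := hG.map_eq_gaussianReal
  rw [hmean0] at hmap
  constructor
  · have := mgf_gaussianReal hmap 1
    -- A non-integrable exponential would have integral 0, contradicting the positive Gaussian
    -- value.
    by_contra hni
    rw [mgf, integral_undef (by simpa using hni)] at this
    exact (Real.exp_pos _).ne this
  · have := mgf_gaussianReal hmap 1
    simp only [mgf, one_mul] at this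
    rw [this, ← hvar, Real.coe_toNNReal _ (variance_nonneg _ _)]
    simp

lemma integrable_exp_linearCombination_drift (hW : IsGaussianProcess W P)
    (hmean : ∀ t, ∫ ω, W t ω ∂P = 0) {ι : Type*} [Fintype ι] (f : ι → T) (a : ι → ℝ) :
    Integrable (fun ω ↦ Real.exp (∑ i, a i * (W (f i) ω - Var[W (f i); P] / 2))) P := by
  have := ((integral_exp_linearCombination hW hmean f a).1).mul_const
    (Real.exp (-(∑ i, a i * (Var[W (f i); P] / 2))))
  refine this.congr (ae_of_all _ fun ω ↦ ?_)
  dsimp only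
  rw [← Real.exp_add, ← sub_eq_add_neg, ← Finset.sum_sub_distrib]
  simp_rw [mul_sub]

variable [AddCommGroup T]

lemma covariance_eq_of_stationary_increments (hW : IsGaussianProcess W P)
    (hinc : ∀ x h, Var[fun ω ↦ W (x + h) ω - W x ω; P] = Var[W h; P]) (s r : T) :
    cov[W s, W r; P] = (Var[W s; P] + Var[W r; P] - Var[W (s - r); P]) / 2 := by
  have := hW.isProbabilityMeasure
  have h := hinc r (s - r)
  rw [add_sub_cancel] at h
  rw [variance_fun_sub (hW.hasGaussianLaw_eval s).memLp_two
    (hW.hasGaussianLaw_eval r).memLp_two] at h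
  linarith

/-- Isolates the total weight ∑ a_i in a Gaussian exponent whose covariances are written through
variances. -/
lemma sum_sum_polarized {ι : Type*} [Fintype ι] (a x : ι → ℝ) (D : ι → ι → ℝ) :
    ∑ i, ∑ j, a i * a j * ((x i + x j - D i j) / 2)
      = (∑ i, a i) * (∑ i, a i * x i) - (∑ i, ∑ j, a i * a j * D i j) / 2 := by
  have h1 : (∑ i, a i) * (∑ i, a i * x i) = ∑ i, ∑ j, a i * (a j * x j) :=
    Finset.sum_mul_sum ..
  have h2 : (∑ i, a i) * (∑ i, a i * x i) = ∑ i, ∑ j, (a i * x i) * a j := by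
    rw [mul_comm, Finset.sum_mul_sum]
  have h3 : (∑ i, a i) * (∑ i, a i * x i)
      = ((∑ i, ∑ j, a i * (a j * x j)) + ∑ i, ∑ j, (a i * x i) * a j) / 2 := by
    rw [← h1, ← h2]
    ring
  rw [h3, ← Finset.sum_add_distrib, ← sub_div, ← Finset.sum_sub_distrib, Finset.sum_div]
  refine Finset.sum_congr rfl fun i _ ↦ ?_
  rw [← Finset.sum_add_distrib, ← Finset.sum_sub_distrib, Finset.sum_div]
  refine Finset.sum_congr rfl fun j _ ↦ ?_
  ring

/-- With v = Var W, a combination of drifted values with weights b_i at points s_i has log-moment (∑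
b - 1)(∑ b_i v(s_i))/2 - (∑∑ b_i b_j v(s_i - s_j))/4. On the tilted side ∑ b = 1, and the cross
terms with t restore the linear term of the other side. -/
lemma integral_exp_shift (hW : IsGaussianProcess W P)
    (hmean : ∀ t, ∫ ω, W t ω ∂P = 0)
    (hinc : ∀ x h, Var[fun ω ↦ W (x + h) ω - W x ω; P] = Var[W h; P])
    (t : T) {ι : Type*} [Fintype ι] (f : ι → T) (a : ι → ℝ) :
    ∫ ω, Real.exp ((W t ω - Var[W t; P] / 2) + ∑ i, a i *
      ((W (f i + t) ω - Var[W (f i + t); P] / 2) - (W t ω - Var[W t; P] / 2))) ∂P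
      = ∫ ω, Real.exp (∑ i, a i * (W (f i) ω - Var[W (f i); P] / 2)) ∂P := by
  set v : T → ℝ := fun s ↦ Var[W s; P] with hv
  have hcov := covariance_eq_of_stationary_increments hW hinc
  have hv0 : v 0 = 0 := by
    have h := hinc 0 0
    simp only [add_zero, sub_self] at h
    rw [hv]
    change Var[W 0; P] = 0
    rw [← h]
    exact variance_zero P
  have hR : ∀ ω, Real.exp (∑ i, a i * (W (f i) ω - v (f i) / 2))
      = Real.exp (∑ i, a i * W (f i) ω) * Real.exp (-(∑ i, a i * v (f i)) / 2) := by
    intro ω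
    rw [← Real.exp_add]
    congr 1
    simp_rw [mul_sub, Finset.sum_sub_distrib, mul_div_assoc', ← Finset.sum_div]
    ring
  let f' : Option ι → T := fun o ↦ o.elim t fun i ↦ f i + t
  -- The index `none` stands for t: weight 1 from the tilt, minus ∑ a_i from recentring, so the
  -- total weight is 1.
  let b : Option ι → ℝ := fun o ↦ o.elim (1 - ∑ i, a i) a
  have hL : ∀ ω, Real.exp ((W t ω - v t / 2) + ∑ i, a i *
      ((W (f i + t) ω - v (f i + t) / 2) - (W t ω - v t / 2)))
      = Real.exp (∑ o, b o * W (f' o) ω) *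
        Real.exp (-(v t + ∑ i, a i * v (f i + t) - (∑ i, a i) * v t) / 2) := by
    intro ω
    rw [← Real.exp_add]
    congr 1
    rw [Fintype.sum_option]
    simp only [b, f', Option.elim]
    simp_rw [mul_sub, Finset.sum_sub_distrib, mul_div_assoc', ← Finset.sum_div, ← Finset.sum_mul]
    ring
  change ∫ ω, Real.exp ((W t ω - v t / 2) + ∑ i, a i *
      ((W (f i + t) ω - v (f i + t) / 2) - (W t ω - v t / 2))) ∂P
      = ∫ ω, Real.exp (∑ i, a i * (W (f i) ω - v (f i) / 2)) ∂P
  simp_rw [hR, hL]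
  rw [integral_mul_const, integral_mul_const, (integral_exp_linearCombination hW hmean f a).2,
    (integral_exp_linearCombination hW hmean f' b).2, ← Real.exp_add, ← Real.exp_add]
  congr 1
  simp_rw [hcov]
  change (∑ i, ∑ j, b i * b j * ((v (f' i) + v (f' j) - v (f' i - f' j)) / 2)) / 2 + _
    = (∑ i, ∑ j, a i * a j * ((v (f i) + v (f j) - v (f i - f j)) / 2)) / 2 + _
  rw [sum_sum_polarized a (fun i ↦ v (f i)) fun i j ↦ v (f i - f j),
    sum_sum_polarized b (fun i ↦ v (f' i)) fun i j ↦ v (f' i - f' j)]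
  have hvneg : ∀ s, v (-s) = v s := by
    intro s
    have h1 := hcov s 0
    have h2 := hcov 0 s
    rw [covariance_comm, h2, sub_zero, zero_sub] at h1
    change (v 0 + v s - v (-s)) / 2 = (v s + v 0 - v s) / 2 at h1
    linarith
  simp only [Fintype.sum_option, b, f', Option.elim, sub_self, hv0, add_sub_cancel_right,
    add_sub_add_right_eq_sub, sub_add_cancel_right, hvneg]
  simp_rw [mul_assoc, Finset.sum_add_distrib, ← Finset.mul_sum]
  have e : ∑ i, a i * ((1 - ∑ i, a i) * v (f i)) = (1 - ∑ i, a i) * ∑ i, a i * v (f i) := by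
    rw [Finset.mul_sum]
    exact Finset.sum_congr rfl fun i _ ↦ by ring
  rw [e]
  ring

/-- Finite-dimensional marginals have equal moment generating functions by `integral_exp_shift`, and
they determine the law on the product space. -/
lemma map_tilted_shift_eq (hW : IsGaussianProcess W P) (hWm : ∀ t, Measurable (W t))
    (hmean : ∀ t, ∫ ω, W t ω ∂P = 0)
    (hinc : ∀ x h, Var[fun ω ↦ W (x + h) ω - W x ω; P] = Var[W h; P]) (t : T) :
    (P.withDensity fun ω ↦ ENNReal.ofReal (Real.exp (W t ω - Var[W t; P] / 2))).map
      (fun ω s ↦ (W (s + t) ω - Var[W (s + t); P] / 2) - (W t ω - Var[W t; P] / 2))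
      = P.map fun ω s ↦ W s ω - Var[W s; P] / 2 := by
  have := hW.isProbabilityMeasure
  have hξ : ∀ s, Measurable fun ω ↦ W s ω - Var[W s; P] / 2 := fun s ↦ (hWm s).sub_const _
  have hdens : Measurable fun ω ↦ Real.exp (W t ω - Var[W t; P] / 2) :=
    Real.measurable_exp.comp (hξ t)
  have hfin : IsFiniteMeasure
      (P.withDensity fun ω ↦ ENNReal.ofReal (Real.exp (W t ω - Var[W t; P] / 2))) := by
    refine isFiniteMeasure_withDensity_ofReal ?_
    have := integrable_exp_linearCombination_drift hW hmean (fun _ : Unit ↦ t) fun _ ↦ 1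
    simpa using this.2
  have hshift : Measurable fun ω s ↦
      (W (s + t) ω - Var[W (s + t); P] / 2) - (W t ω - Var[W t; P] / 2) :=
    measurable_pi_lambda _ fun s ↦ (hξ (s + t)).sub (hξ t)
  have hξm : Measurable fun ω s ↦ W s ω - Var[W s; P] / 2 := measurable_pi_lambda _ hξ
  have := Measure.isProbabilityMeasure_map (μ := P) hξm.aemeasurable
  refine IsProjectiveLimit.unique
    (P := fun I : Finset T ↦ (P.map fun ω s ↦ W s ω - Var[W s; P] / 2).map I.restrict)
    (fun I ↦ ?_) fun I ↦ rfl
  have hr := I.measurable_restrict (X := fun _ : T ↦ ℝ)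
  have := Measure.isProbabilityMeasure_map
    (μ := P.map fun ω s ↦ W s ω - Var[W s; P] / 2) hr.aemeasurable
  have hcont : ∀ a : I → ℝ, Measurable fun x : I → ℝ ↦ Real.exp (∑ i, a i * x i) :=
    fun a ↦ by fun_prop
  change _ = (P.map fun ω s ↦ W s ω - Var[W s; P] / 2).map I.restrict
  rw [Measure.map_map hr hshift, Measure.map_map hr hξm]
  rw [Measure.map_map hr hξm] at this
  refine (measure_pi_ext_of_integral_exp (fun a ↦ ?_) fun a ↦ ?_).symm
  · rw [integrable_map_measure (hcont a).aestronglyMeasurable (hr.comp hξm).aemeasurable]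
    exact integrable_exp_linearCombination_drift hW hmean (fun i : I ↦ (i : T)) a
  · rw [integral_map (hr.comp hξm).aemeasurable (hcont a).aestronglyMeasurable,
      integral_map (hr.comp hshift).aemeasurable (hcont a).aestronglyMeasurable,
      integral_withDensity_eq_integral_toReal_smul hdens.ennreal_ofReal (by simp)]
    have h := integral_exp_shift hW hmean hinc t (fun i : I ↦ (i : T)) a
    refine h.symm.trans (integral_congr_ae (ae_of_all _ fun ω ↦ ?_))
    simp only [Real.exp_add, ENNReal.toReal_ofReal (Real.exp_pos _).le, smul_eq_mul]
    rfl

/-- The change of measure formula for the shifted process. -/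
lemma lintegral_shift_eq (hW : IsGaussianProcess W P) (hWm : ∀ t, Measurable (W t))
    (hmean : ∀ t, ∫ ω, W t ω ∂P = 0)
    (hinc : ∀ x h, Var[fun ω ↦ W (x + h) ω - W x ω; P] = Var[W h; P]) (t : T)
    {Φ : (T → ℝ) → ENNReal} (hΦ : Measurable Φ) :
    ∫⁻ f, ENNReal.ofReal (Real.exp (f t)) * Φ (fun s ↦ f (s + t) - f t)
        ∂(P.map fun ω s ↦ W s ω - Var[W s; P] / 2)
      = ∫⁻ f, Φ f ∂(P.map fun ω s ↦ W s ω - Var[W s; P] / 2) := by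
  have hξ : ∀ s, Measurable fun ω ↦ W s ω - Var[W s; P] / 2 := fun s ↦ (hWm s).sub_const _
  have hξm : Measurable fun ω s ↦ W s ω - Var[W s; P] / 2 := measurable_pi_lambda _ hξ
  have hshift : Measurable fun ω s ↦
      (W (s + t) ω - Var[W (s + t); P] / 2) - (W t ω - Var[W t; P] / 2) :=
    measurable_pi_lambda _ fun s ↦ (hξ (s + t)).sub (hξ t)
  have hdens : Measurable fun ω ↦ ENNReal.ofReal (Real.exp (W t ω - Var[W t; P] / 2)) :=
    (Real.measurable_exp.comp (hξ t)).ennreal_ofReal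
  have hs : Measurable fun (f : T → ℝ) s ↦ f (s + t) - f t := by fun_prop
  have hexp : Measurable fun f : T → ℝ ↦ ENNReal.ofReal (Real.exp (f t)) := by fun_prop
  have hmul : Measurable fun f : T → ℝ ↦
      ENNReal.ofReal (Real.exp (f t)) * Φ (fun s ↦ f (s + t) - f t) := hexp.mul (hΦ.comp hs)
  conv_rhs => rw [← map_tilted_shift_eq hW hWm hmean hinc t]
  rw [lintegral_map hΦ hshift, lintegral_map hmul hξm,
    lintegral_withDensity_eq_lintegral_mul₀ (g := fun ω ↦ Φ _) hdens.aemeasurable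
      (hΦ.comp hshift).aemeasurable]
  rfl

end Shift

/-! ### Smallest maximizers of functions on the lattice -/

section Lattice

variable {d : ℕ} {p : ℝ}

instance : Countable (lattice d p) := by
  have : Function.Surjective fun k : Fin d → ℤ ↦
      (⟨WithLp.toLp 2 fun i ↦ p * k i, k, fun i ↦ rfl⟩ : lattice d p) := by
    rintro ⟨t, k, hk⟩
    refine ⟨k, Subtype.ext ?_⟩
    ext i
    exact (hk i).symm
  exact this.countable

lemma toLex_add_le_iff (s t u : lattice d p) :
    toLex (WithLp.ofLp ((s + u : lattice d p) : EuclideanSpace ℝ (Fin d))) ≤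
        toLex (WithLp.ofLp ((t + u : lattice d p) : EuclideanSpace ℝ (Fin d))) ↔
      toLex (WithLp.ofLp (s : EuclideanSpace ℝ (Fin d))) ≤
        toLex (WithLp.ofLp (t : EuclideanSpace ℝ (Fin d))) := by
  simp only [AddSubgroup.coe_add, WithLp.ofLp_add, toLex_add]
  exact add_le_add_iff_right _

lemma IsSmallestArgmax.unique {f : lattice d p → ℝ} {s t : lattice d p}
    (hs : IsSmallestArgmax f s) (ht : IsSmallestArgmax f t) : s = t :=
  Subtype.ext (WithLp.ofLp_injective 2
    (toLex.injective (le_antisymm (hs.2 t ht.1) (ht.2 s hs.1))))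

lemma isSmallestArgmax_smallestArgmax {f : lattice d p → ℝ} (h : ∃ t, IsSmallestArgmax f t) :
    IsSmallestArgmax f (smallestArgmax f) := by
  rw [smallestArgmax, dif_pos h]
  exact h.choose_spec

lemma IsSmallestArgmax.smallestArgmax_eq {f : lattice d p → ℝ} {t : lattice d p}
    (h : IsSmallestArgmax f t) : smallestArgmax f = t :=
  (isSmallestArgmax_smallestArgmax ⟨t, h⟩).unique h

lemma IsSmallestArgmax.iSup_eq {f : lattice d p → ℝ} {t : lattice d p}
    (h : IsSmallestArgmax f t) : ⨆ s, f s = f t :=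
  le_antisymm (ciSup_le h.1) (le_ciSup (f := f) ⟨f t, by rintro _ ⟨s, rfl⟩; exact h.1 s⟩ t)

lemma IsSmallestArgmax.decompose_eq {f : lattice d p → ℝ} {t : lattice d p}
    (h : IsSmallestArgmax f t) (x : ℝ) :
    decompose x f = (t, x + f t, fun s ↦ f (s + t) - f t) := by
  rw [decompose, h.smallestArgmax_eq, h.iSup_eq]

/-- Subtracting a constant keeps the maximizers, and translation preserves the lexicographic order.
-/
lemma isSmallestArgmax_shift_iff {f : lattice d p → ℝ} {t : lattice d p} :
    IsSmallestArgmax (fun s ↦ f (s + t) - f t) 0 ↔ IsSmallestArgmax f t := by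
  have hall : ∀ r : lattice d p,
      (∀ s, f (s + t) - f t ≤ f (r + t) - f t) ↔ ∀ s, f s ≤ f (r + t) := by
    intro r
    simp only [sub_le_sub_iff_right]
    exact ⟨fun h s ↦ by simpa using h (s - t), fun h s ↦ h _⟩
  unfold IsSmallestArgmax
  rw [hall, zero_add]
  refine and_congr_right fun _ ↦ ⟨fun h t' ht' ↦ ?_, fun h t' ht' ↦ ?_⟩
  · have := h (t' - t) ((hall _).2 (by simpa using ht'))
    rw [← toLex_add_le_iff _ _ t] at this
    simpa using this
  · rw [← toLex_add_le_iff _ _ t, zero_add]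
    exact h _ ((hall _).1 ht')

/-- The lexicographic order on the lattice is not well-founded in general, so the set of maximizers
must be finite for a smallest one to exist. -/
lemma exists_isSmallestArgmax {f : lattice d p → ℝ} (hf : {s | f 0 ≤ f s}.Finite) :
    ∃ t, IsSmallestArgmax f t := by
  obtain ⟨m, hm, hmax⟩ := Set.exists_max_image _ f hf ⟨0, le_refl (f 0)⟩
  have hm' : ∀ s, f s ≤ f m := by
    intro s
    rcases le_total (f 0) (f s) with h | h
    · exact hmax s h
    · exact h.trans hm
  have hfin : {t | ∀ s, f s ≤ f t}.Finite := hf.subset fun t ht ↦ ht 0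
  obtain ⟨t, ht, hmin⟩ := Set.exists_min_image _
    (fun t : lattice d p ↦ toLex (WithLp.ofLp (t : EuclideanSpace ℝ (Fin d)))) hfin ⟨m, hm'⟩
  exact ⟨t, ht, hmin⟩

lemma lattice_finite_of_isBounded (hp : 0 < p) {K : Set (EuclideanSpace ℝ (Fin d))}
    (hK : Bornology.IsBounded K) : {t : lattice d p | (t : EuclideanSpace ℝ (Fin d)) ∈ K}.Finite := by
  obtain ⟨R, hR⟩ := hK.exists_norm_le
  have hfin : (Set.univ.pi fun _ : Fin d ↦ Set.Icc (-⌈R / p⌉) ⌈R / p⌉).Finite :=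
    Set.Finite.pi fun _ ↦ Set.finite_Icc _ _
  refine (hfin.image fun k : Fin d → ℤ ↦
      (⟨WithLp.toLp 2 fun i ↦ p * k i, k, fun i ↦ rfl⟩ : lattice d p)).subset ?_
  rintro ⟨t, k, hk⟩ ht
  refine ⟨k, fun i _ ↦ ?_, Subtype.ext (by ext i; exact (hk i).symm)⟩
  have h1 : |t i| ≤ R := (PiLp.norm_apply_le t i).trans (hR t ht)
  rw [hk i, abs_mul, abs_of_pos hp, mul_comm, ← le_div_iff₀ hp] at h1
  have h2 := (abs_le.1 (h1.trans (Int.le_ceil (R / p))))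
  exact ⟨by exact_mod_cast h2.1, by exact_mod_cast h2.2⟩

lemma exists_isSmallestArgmax_of_tendsto (hp : 0 < p) {g : EuclideanSpace ℝ (Fin d) → ℝ}
    (hg : Tendsto g (cocompact _) atBot) :
    ∃ t, IsSmallestArgmax (fun s : lattice d p ↦ g s) t := by
  refine exists_isSmallestArgmax ?_
  have h := hg.eventually (eventually_lt_atBot (g (0 : lattice d p)))
  obtain ⟨K, hK, hsub⟩ := mem_cocompact.1 h
  refine (lattice_finite_of_isBounded hp hK.isBounded).subset fun s hs ↦ ?_
  by_contra hsK
  exact absurd (show g s < g (0 : lattice d p) from hsub hsK) (not_lt.2 hs)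

lemma measurableSet_isSmallestArgmax (t : lattice d p) :
    MeasurableSet {f : lattice d p → ℝ | IsSmallestArgmax f t} := by
  have hmax : ∀ t : lattice d p, Measurable fun f : lattice d p → ℝ ↦ ∀ s, f s ≤ f t := fun t ↦
    Measurable.forall fun s ↦
      measurableSet_setOfPred.1 (measurableSet_le (measurable_pi_apply s) (measurable_pi_apply t))
  exact measurableSet_setOfPred.2
    ((hmax t).and (Measurable.forall fun t' ↦ (hmax t').imp measurable_const))

lemma measurableSet_exists_isSmallestArgmax :
    MeasurableSet {f : lattice d p → ℝ | ∃ t, IsSmallestArgmax f t} := by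
  rw [Set.ofPred_exists]
  exact MeasurableSet.iUnion measurableSet_isSmallestArgmax

lemma measurable_smallestArgmax : Measurable (smallestArgmax (d := d) (p := p)) := by
  refine measurable_to_countable' fun t ↦ ?_
  -- The second set accounts for the default value 0 when there is no smallest maximizer.
  have : smallestArgmax ⁻¹' {t} = {f : lattice d p → ℝ | IsSmallestArgmax f t} ∪
      ({f | ¬ ∃ s, IsSmallestArgmax f s} ∩ {_f | t = 0}) := by
    ext f
    by_cases h : ∃ s, IsSmallestArgmax f s
    · obtain ⟨s, hs⟩ := h
      have hex : ∃ s, IsSmallestArgmax f s := ⟨s, hs⟩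
      simp only [Set.mem_preimage, Set.mem_singleton_iff, hs.smallestArgmax_eq, Set.mem_union,
        Set.mem_ofPred_eq, Set.mem_inter_iff, hex, not_true_eq_false, false_and, or_false]
      exact ⟨fun e ↦ e ▸ hs, fun ht ↦ hs.unique ht⟩
    · have hn : ¬ IsSmallestArgmax f t := fun ht ↦ h ⟨t, ht⟩
      have h0 : smallestArgmax f = 0 := by rw [smallestArgmax, dif_neg h]
      simp only [Set.mem_preimage, Set.mem_singleton_iff, h0, Set.mem_union,
        Set.mem_ofPred_eq, Set.mem_inter_iff, h, not_false_eq_true, true_and, hn, false_or]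
      exact eq_comm
  rw [this]
  refine (measurableSet_isSmallestArgmax t).union (MeasurableSet.inter ?_ (.const _))
  exact measurableSet_exists_isSmallestArgmax.compl

lemma measurable_decompose :
    Measurable fun q : ℝ × (lattice d p → ℝ) ↦ decompose q.1 q.2 := by
  have hT : Measurable fun q : ℝ × (lattice d p → ℝ) ↦ smallestArgmax q.2 :=
    measurable_smallestArgmax.comp measurable_snd
  have hM : Measurable fun q : ℝ × (lattice d p → ℝ) ↦ ⨆ s, q.2 s :=
    Measurable.iSup fun s ↦ (measurable_pi_apply s).comp measurable_snd
  refine hT.prodMk ((measurable_fst.add hM).prodMk (measurable_pi_lambda _ fun t ↦ ?_))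
  refine Measurable.sub ?_ hM
  -- Evaluation at a path-dependent site is jointly measurable because the lattice is countable.
  have heval : Measurable fun r : (lattice d p → ℝ) × lattice d p ↦ r.1 (t + r.2) :=
    measurable_from_prod_countable_left fun s ↦ measurable_pi_apply (t + s)
  exact heval.comp (measurable_snd.prodMk hT)

end Lattice

/-! ### The intensity measure of the decomposed points -/

section Intensity

instance : SigmaFinite expNegMeasure := by
  unfold expNegMeasure
  infer_instance

lemma measurable_exp_neg_ofReal : Measurable fun x : ℝ ↦ ENNReal.ofReal (Real.exp (-x)) := by
  fun_prop

lemma expNegMeasure_preimage_add {B : Set ℝ} (hB : MeasurableSet B) (m : ℝ) :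
    expNegMeasure {x | x + m ∈ B} = ENNReal.ofReal (Real.exp m) * expNegMeasure B := by
  have hB' : MeasurableSet {x | x + m ∈ B} := measurable_add_const m hB
  rw [expNegMeasure, withDensity_apply _ hB', withDensity_apply _ hB,
    ← lintegral_indicator hB', ← lintegral_indicator hB,
    ← lintegral_const_mul _ (measurable_exp_neg_ofReal.indicator hB),
    ← lintegral_add_right_eq_self (fun x ↦ ENNReal.ofReal (Real.exp m) *
      B.indicator (fun x ↦ ENNReal.ofReal (Real.exp (-x))) x) m]
  refine lintegral_congr fun x ↦ ?_
  by_cases hx : x + m ∈ B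
  · rw [Set.indicator_of_mem hx, Set.indicator_of_mem (show x ∈ {x | x + m ∈ B} from hx),
      ← ENNReal.ofReal_mul (Real.exp_pos _).le, ← Real.exp_add]
    congr 2
    ring
  · rw [Set.indicator_of_notMem hx, Set.indicator_of_notMem
      (show x ∉ {x | x + m ∈ B} from hx), mul_zero]

lemma expNegMeasure_Icc_ne_zero : expNegMeasure (Set.Icc 0 1) ≠ 0 := by
  rw [expNegMeasure, withDensity_apply _ measurableSet_Icc]
  have h : ∫⁻ _x in Set.Icc (0 : ℝ) 1, ENNReal.ofReal (Real.exp (-1))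
      ≤ ∫⁻ x in Set.Icc (0 : ℝ) 1, ENNReal.ofReal (Real.exp (-x)) :=
    setLIntegral_mono measurable_exp_neg_ofReal fun x hx ↦
      ENNReal.ofReal_le_ofReal (Real.exp_le_exp.2 (neg_le_neg hx.2))
  refine (lt_of_lt_of_le ?_ h).ne'
  simp [Real.exp_pos]

lemma expNegMeasure_Icc_ne_top : expNegMeasure (Set.Icc 0 1) ≠ ⊤ := by
  rw [expNegMeasure, withDensity_apply _ measurableSet_Icc]
  have h : ∫⁻ x in Set.Icc (0 : ℝ) 1, ENNReal.ofReal (Real.exp (-x))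
      ≤ ∫⁻ _x in Set.Icc (0 : ℝ) 1, 1 :=
    setLIntegral_mono measurable_const fun x hx ↦ by
      rw [ENNReal.ofReal_le_one, Real.exp_le_one_iff]
      linarith [hx.1]
  refine (lt_of_le_of_lt h ?_).ne
  simp

variable {d : ℕ} {p : ℝ}

/-- The shape measure is determined by the intensity measure. -/
lemma productIntensity_injective {l l' : ℝ} {Q Q' : Measure (lattice d p → ℝ)}
    [IsProbabilityMeasure Q] [IsProbabilityMeasure Q'] (hp : 0 < p) (hl : 0 < l)
    (h : productIntensity d p l Q = productIntensity d p l' Q') : Q = Q' := by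
  -- The window {0} × [0,1] has finite positive mass; A = univ equates the constants, and then Q(A)
  -- can be read off.
  have key : ∀ (l : ℝ) (Q : Measure (lattice d p → ℝ)) [IsProbabilityMeasure Q]
      (A : Set (lattice d p → ℝ)),
      productIntensity d p l Q ({0} ×ˢ (Set.Icc 0 1 ×ˢ A))
        = ENNReal.ofReal (l * p ^ d) * expNegMeasure (Set.Icc 0 1) * Q A := by
    intro l Q _ A
    rw [productIntensity, Measure.smul_apply, Measure.prod_prod, Measure.prod_prod,
      Measure.count_singleton, one_mul, smul_eq_mul, mul_assoc]
  have hc : ENNReal.ofReal (l * p ^ d) * expNegMeasure (Set.Icc 0 1)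
      = ENNReal.ofReal (l' * p ^ d) * expNegMeasure (Set.Icc 0 1) := by
    have h1 := key l Q Set.univ
    rw [h, key l' Q' Set.univ, measure_univ, measure_univ, mul_one, mul_one] at h1
    exact h1.symm
  ext A _
  have h1 := key l Q A
  rw [h, key l' Q' A, ← hc] at h1
  refine ((ENNReal.mul_right_inj (mul_ne_zero ?_ expNegMeasure_Icc_ne_zero)
    (ENNReal.mul_ne_top ENNReal.ofReal_ne_top expNegMeasure_Icc_ne_top)).1 h1).symm
  rw [Ne, ENNReal.ofReal_eq_zero, not_le]
  positivity

/-- The slices of a measurable set of triples. -/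
def sliceMass (C : Set (lattice d p × ℝ × (lattice d p → ℝ))) (t : lattice d p)
    (f : lattice d p → ℝ) : ENNReal :=
  expNegMeasure {u | (t, u, f) ∈ C}

lemma measurable_sliceMass {C : Set (lattice d p × ℝ × (lattice d p → ℝ))}
    (hC : MeasurableSet C) (t : lattice d p) : Measurable (sliceMass C t) := by
  have hCt : MeasurableSet {q : ℝ × (lattice d p → ℝ) | (t, q.1, q.2) ∈ C} :=
    (measurable_const.prodMk measurable_id) hC
  exact measurable_measure_prodMk_right hCt

/-- Only the true maximizer contributes to the sum. Summing over all sites prepares for applying the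
shift formula term by term after integrating over f. -/
lemma IsSmallestArgmax.expNegMeasure_decompose {f : lattice d p → ℝ} {t : lattice d p}
    (h : IsSmallestArgmax f t) {C : Set (lattice d p × ℝ × (lattice d p → ℝ))}
    (hC : MeasurableSet C) :
    expNegMeasure {x | decompose x f ∈ C} = ∑' t, ENNReal.ofReal (Real.exp (f t)) *
      {g | IsSmallestArgmax g 0}.indicator (sliceMass C t) (fun s ↦ f (s + t) - f t) := by
  rw [tsum_eq_single t]
  · rw [Set.indicator_of_mem (show _ ∈ {g | IsSmallestArgmax g 0} from
      isSmallestArgmax_shift_iff.2 h), sliceMass]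
    have hCt : MeasurableSet {u : ℝ | (t, u, fun s ↦ f (s + t) - f t) ∈ C} :=
      (measurable_const.prodMk (measurable_id.prodMk measurable_const)) hC
    rw [← expNegMeasure_preimage_add hCt]
    simp_rw [h.decompose_eq]
    rfl
  · intro t' ht'
    rw [Set.indicator_of_notMem, mul_zero]
    exact fun h' ↦ ht' ((isSmallestArgmax_shift_iff.1 h').unique h)

lemma map_decompose_apply {ν : Measure (lattice d p → ℝ)} [IsProbabilityMeasure ν]
    (hex : ∀ᵐ f ∂ν, ∃ t, IsSmallestArgmax f t)
    (hshift : ∀ (t : lattice d p) (Φ : (lattice d p → ℝ) → ENNReal), Measurable Φ →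
      ∫⁻ f, ENNReal.ofReal (Real.exp (f t)) * Φ (fun s ↦ f (s + t) - f t) ∂ν = ∫⁻ f, Φ f ∂ν)
    {C : Set (lattice d p × ℝ × (lattice d p → ℝ))} (hC : MeasurableSet C) :
    ((expNegMeasure.prod ν).map fun q ↦ decompose q.1 q.2) C
      = ∑' t, ∫⁻ f in {f | IsSmallestArgmax f 0}, sliceMass C t f ∂ν := by
  have hA := measurableSet_isSmallestArgmax (0 : lattice d p)
  have hΦ : ∀ t, Measurable ({g | IsSmallestArgmax g 0}.indicator (sliceMass C t)) := fun t ↦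
    (measurable_sliceMass hC t).indicator hA
  rw [Measure.map_apply measurable_decompose hC,
    Measure.prod_apply_symm (measurable_decompose hC)]
  have h1 : ∫⁻ f, expNegMeasure ((fun x ↦ (x, f)) ⁻¹'
        ((fun q : ℝ × (lattice d p → ℝ) ↦ decompose q.1 q.2) ⁻¹' C)) ∂ν
      = ∫⁻ f, ∑' t, ENNReal.ofReal (Real.exp (f t)) *
        {g | IsSmallestArgmax g 0}.indicator (sliceMass C t) (fun s ↦ f (s + t) - f t) ∂ν := by
    refine lintegral_congr_ae ?_
    filter_upwards [hex] with f hf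
    obtain ⟨t, ht⟩ := hf
    exact ht.expNegMeasure_decompose hC
  rw [h1, lintegral_tsum]
  · refine tsum_congr fun t ↦ ?_
    rw [hshift t _ (hΦ t), lintegral_indicator hA]
  · intro t
    have hs : Measurable fun (f : lattice d p → ℝ) s ↦ f (s + t) - f t := by fun_prop
    have he : Measurable fun f : lattice d p → ℝ ↦ ENNReal.ofReal (Real.exp (f t)) := by fun_prop
    exact (he.mul ((hΦ t).comp hs)).aemeasurable

/-- Otherwise every site would contribute 0, and the image of a nonzero measure would be zero. -/
lemma measure_isSmallestArgmax_zero_ne_zero {ν : Measure (lattice d p → ℝ)}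
    [IsProbabilityMeasure ν] (hex : ∀ᵐ f ∂ν, ∃ t, IsSmallestArgmax f t)
    (hshift : ∀ (t : lattice d p) (Φ : (lattice d p → ℝ) → ENNReal), Measurable Φ →
      ∫⁻ f, ENNReal.ofReal (Real.exp (f t)) * Φ (fun s ↦ f (s + t) - f t) ∂ν = ∫⁻ f, Φ f ∂ν) :
    ν {f | IsSmallestArgmax f 0} ≠ 0 := by
  intro h0
  have h := map_decompose_apply hex hshift MeasurableSet.univ
  simp_rw [Measure.restrict_eq_zero.2 h0, lintegral_zero_measure, tsum_zero] at h
  rw [Measure.map_apply measurable_decompose .univ, Set.preimage_univ, ← Set.univ_prod_univ,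
    Measure.prod_prod, measure_univ (μ := ν), mul_one] at h
  exact expNegMeasure_Icc_ne_zero (measure_mono_null (Set.subset_univ _) h)

lemma map_decompose_eq_productIntensity {ν : Measure (lattice d p → ℝ)}
    [IsProbabilityMeasure ν] (hp : 0 < p) (hex : ∀ᵐ f ∂ν, ∃ t, IsSmallestArgmax f t)
    (hshift : ∀ (t : lattice d p) (Φ : (lattice d p → ℝ) → ENNReal), Measurable Φ →
      ∫⁻ f, ENNReal.ofReal (Real.exp (f t)) * Φ (fun s ↦ f (s + t) - f t) ∂ν = ∫⁻ f, Φ f ∂ν) :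
    (expNegMeasure.prod ν).map (fun q ↦ decompose q.1 q.2)
      = productIntensity d p ((ν {f | IsSmallestArgmax f 0}).toReal / p ^ d)
        (ν[|{f | IsSmallestArgmax f 0}]) := by
  have h0 := measure_isSmallestArgmax_zero_ne_zero hex hshift
  ext C hC
  rw [map_decompose_apply hex hshift hC, productIntensity, div_mul_cancel₀ _ (by positivity),
    ENNReal.ofReal_toReal (measure_ne_top _ _), Measure.smul_apply, Measure.prod_apply hC,
    lintegral_count, smul_eq_mul, ← ENNReal.tsum_mul_left]
  refine tsum_congr fun t ↦ ?_
  have hCt : MeasurableSet (Prod.mk t ⁻¹' C) := measurable_prodMk_left hC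
  rw [Measure.prod_apply_symm hCt, ProbabilityTheory.cond,
    lintegral_smul_measure, smul_eq_mul, ← mul_assoc,
    ENNReal.mul_inv_cancel h0 (measure_ne_top _ _), one_mul]
  rfl

end Intensity


/-! ### Increment variances, conditioning, and the main theorem -/

/-- The lag-zero covariance of the increment field is its variance; stationarity moves x to 0, where
W(0) = 0. -/
lemma IsCentredIntrinsicGaussianField.variance_increment {d : ℕ} {Ω : Type*} [MeasurableSpace Ω]
    {W : EuclideanSpace ℝ (Fin d) → Ω → ℝ} {P : Measure Ω}
    (hW : IsCentredIntrinsicGaussianField W P) (hW0 : ∀ᵐ ω ∂P, W 0 ω = 0)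
    (x h : EuclideanSpace ℝ (Fin d)) :
    Var[fun ω ↦ W (x + h) ω - W x ω; P] = Var[W h; P] := by
  have hm : ∀ x, AEMeasurable (fun ω ↦ W (x + h) ω - W x ω) P := fun x ↦
    ((hW.measurable _).sub (hW.measurable _)).aemeasurable
  have hc := (hW.intrinsic h).covariance 0 x 0
  simp only [zero_add] at hc
  rw [covariance_self (hm x)] at hc
  rw [hc]
  have h0 : (fun ω ↦ W h ω - W 0 ω) =ᵐ[P] W h := by
    filter_upwards [hW0] with ω hω
    rw [hω, sub_zero]
  have hm0 : AEMeasurable (fun ω ↦ W h ω - W 0 ω) P :=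
    ((hW.measurable h).sub (hW.measurable 0)).aemeasurable
  rw [covariance_self hm0]
  exact variance_congr h0

/-- Conditioning on a preimage and pushing forward. -/
lemma map_cond_preimage {Ω S : Type*} [MeasurableSpace Ω] [MeasurableSpace S] {P : Measure Ω}
    {g : Ω → S} (hg : Measurable g) {A : Set S} (hA : MeasurableSet A) :
    (P[|g ⁻¹' A]).map g = (P.map g)[|A] := by
  rw [ProbabilityTheory.cond, ProbabilityTheory.cond, Measure.map_smul, Measure.map_apply hg hA,
    Measure.restrict_map hg hA]

end BrownResnick

end

theorem mainTheorem7 {d : ℕ} {p : ℝ} (hp : 0 < p)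
    {Ω₀ : Type*} [MeasurableSpace Ω₀] (P₀ : Measure Ω₀) [IsProbabilityMeasure P₀]
    (W : EuclideanSpace ℝ (Fin d) → Ω₀ → ℝ)
    (hW : BrownResnick.IsCentredIntrinsicGaussianField W P₀)
    (hlim : ∀ᵐ ω ∂P₀, Tendsto (BrownResnick.driftPath W P₀ fun t ↦ W t ω)
      (cocompact (EuclideanSpace ℝ (Fin d))) atBot)
    (hW0 : ∀ᵐ ω ∂P₀, W 0 ω = 0)
    {Ω : Type*} [MeasurableSpace Ω] (P : Measure Ω) [IsProbabilityMeasure P]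
    (Wi : ℕ → EuclideanSpace ℝ (Fin d) → Ω → ℝ)
    (hWi_meas : ∀ i t, Measurable (Wi i t))
    (hWi_law : ∀ i, IdentDistrib (fun ω t ↦ Wi i t ω) (fun ω t ↦ W t ω) P P₀)
    (hWi_indep : iIndepFun (fun i ω t ↦ Wi i t ω) P)
    (X : ℕ → Ω → ℝ) (hX_meas : ∀ i, Measurable (X i))
    (hX : BrownResnick.IsPoissonPointProcess X BrownResnick.expNegMeasure P)
    (hXW : IndepFun (fun ω i ↦ X i ω) (fun ω i t ↦ Wi i t ω) P) :
    let ξ₀ : Ω₀ → BrownResnick.lattice d p → ℝ :=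
      fun ω t ↦ BrownResnick.driftPath W P₀ (fun s ↦ W s ω) t
    let ξ : ℕ → Ω → EuclideanSpace ℝ (Fin d) → ℝ :=
      fun i ω ↦ BrownResnick.driftPath W P₀ fun s ↦ Wi i s ω
    let zeroArgmax : Set Ω₀ := {ω | BrownResnick.smallestArgmax (ξ₀ ω) = 0}
    MeasurableSet zeroArgmax ∧ P₀ zeroArgmax ≠ 0 ∧
      (∃ l Q, BrownResnick.IsLatticeDecomposition p X ξ P l Q) ∧
      ∀ l Q, BrownResnick.IsLatticeDecomposition p X ξ P l Q →
        Q = (P₀[|zeroArgmax]).map ξ₀ := by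
  intro ξ₀ ξ zeroArgmax
  have hξ₀ : Measurable ξ₀ := measurable_pi_lambda _ fun t ↦ (hW.measurable _).sub_const _
  let ν : Measure (BrownResnick.lattice d p → ℝ) := P₀.map ξ₀
  have hν : IsProbabilityMeasure ν := Measure.isProbabilityMeasure_map hξ₀.aemeasurable
  let A₀ : Set (BrownResnick.lattice d p → ℝ) := {f | BrownResnick.smallestArgmax f = 0}
  have hA₀ : MeasurableSet A₀ :=
    BrownResnick.measurable_smallestArgmax (measurableSet_singleton 0)
  have hex : ∀ᵐ f ∂ν, ∃ t, BrownResnick.IsSmallestArgmax f t := by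
    rw [ae_map_iff hξ₀.aemeasurable BrownResnick.measurableSet_exists_isSmallestArgmax]
    filter_upwards [hlim] with ω hω
    exact BrownResnick.exists_isSmallestArgmax_of_tendsto hp hω
  have hshift : ∀ (t : BrownResnick.lattice d p) (Φ : (BrownResnick.lattice d p → ℝ) → ENNReal),
      Measurable Φ →
      ∫⁻ f, ENNReal.ofReal (Real.exp (f t)) * Φ (fun s ↦ f (s + t) - f t) ∂ν = ∫⁻ f, Φ f ∂ν :=
    fun t Φ hΦ ↦ BrownResnick.lintegral_shift_eq
      -- The lattice is itself a group, so the shift formula applies to the restricted field.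
      (W := fun s : BrownResnick.lattice d p ↦ W s)
      (hW.gaussian.comp_right Subtype.val) (fun s ↦ hW.measurable s) (fun s ↦ hW.mean_zero s)
      (fun x h ↦ hW.variance_increment hW0 x h) t hΦ
  -- The two events differ only on paths without a smallest maximizer, where the default value is 0;
  -- these are null.
  have hA₀_ae : {f | BrownResnick.IsSmallestArgmax f 0} =ᵐ[ν] A₀ := by
    filter_upwards [hex] with f hf
    refine propext ⟨fun h ↦ BrownResnick.IsSmallestArgmax.smallestArgmax_eq h, fun h ↦ ?_⟩
    have := BrownResnick.isSmallestArgmax_smallestArgmax hf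
    rwa [show BrownResnick.smallestArgmax f = 0 from h] at this
  have hcond : ν[|{f | BrownResnick.IsSmallestArgmax f 0}] = (P₀[|zeroArgmax]).map ξ₀ := by
    rw [show zeroArgmax = ξ₀ ⁻¹' A₀ from rfl, BrownResnick.map_cond_preimage hξ₀ hA₀,
      ProbabilityTheory.cond, ProbabilityTheory.cond, measure_congr hA₀_ae,
      Measure.restrict_congr_set hA₀_ae]
  have hne := BrownResnick.measure_isSmallestArgmax_zero_ne_zero hex hshift
  have hpos : P₀ zeroArgmax ≠ 0 := by
    rw [measure_congr hA₀_ae, Measure.map_apply hξ₀ hA₀] at hne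
    exact hne
  have hu : Measurable fun (v : EuclideanSpace ℝ (Fin d) → ℝ) (t : BrownResnick.lattice d p) ↦
      BrownResnick.driftPath W P₀ v t :=
    measurable_pi_lambda _ fun t ↦ (measurable_pi_apply _).sub_const _
  let Z : ℕ → Ω → BrownResnick.lattice d p → ℝ := fun i ω t ↦ ξ i ω t
  have hpoisson : BrownResnick.IsPoissonPointProcess
      (fun i ω ↦ BrownResnick.decompose (X i ω) (Z i ω))
      (BrownResnick.productIntensity d p
        ((ν {f | BrownResnick.IsSmallestArgmax f 0}).toReal / p ^ d)
        (ν[|{f | BrownResnick.IsSmallestArgmax f 0}])) P := by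
    rw [← BrownResnick.map_decompose_eq_productIntensity hp hex hshift]
    refine (hX.mark (Z := Z) hX_meas (fun i ↦ hu.comp (measurable_pi_lambda _ (hWi_meas i)))
      (fun i ↦ ((hWi_law i).comp hu).map_eq) (hWi_indep.comp _ fun _ ↦ hu) ?_).map
      BrownResnick.measurable_decompose
    exact hXW.comp (φ := id)
      (ψ := fun (v : ℕ → EuclideanSpace ℝ (Fin d) → ℝ) i (t : BrownResnick.lattice d p) ↦
        BrownResnick.driftPath W P₀ (v i) t) measurable_id
      (measurable_pi_lambda _ fun i ↦ hu.comp (measurable_pi_apply i))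
  have hprob : IsProbabilityMeasure (ν[|{f | BrownResnick.IsSmallestArgmax f 0}]) :=
    cond_isProbabilityMeasure hne
  refine ⟨hξ₀ hA₀, hpos, ⟨_, _, ⟨div_pos (ENNReal.toReal_pos hne (measure_ne_top _ _))
    (pow_pos hp d), hprob, hpoisson⟩⟩, fun l Q hQ ↦ ?_⟩
  have := hQ.isProbabilityMeasure
  rw [← hcond]
  exact BrownResnick.productIntensity_injective hp hQ.pos
    (hQ.isPoisson.intensity_unique hpoisson)
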